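/- Let $N\ge 1$, $0<\sigma<1$, $s=1+\sigma$, and let $\Omega\subset\mathbb R^N$ be a nonempty bounded open set (for instance a bounded $C^{1,1}$ domain). Let $g_1\in L^p(\mathbb R^N\setminus\Omega)$ with $1\le p\le\infty$, $p>N/2$, and suppose that $g_1$ has compact support (it vanishes almost everywhere on $\mathbb R^N\setminus\Omega$ outside a compact set). Put $$Q(\Omega)=\mathbb R^{2N}\setminus(\mathbb R^N\setminus\Omega)^2,\qquad D(u)^2=\iint_{Q(\Omega)}\frac{|\nabla u(x)-\nabla u(y)|^2}{|x-y|^{N+2\sigma}}\,dx\,dy,\qquad d\mu_{g_1}=(\chi_\Omega+|g_1|\chi_{\mathbb R^N\setminus\Omega})\,dx,$$ where $u:\mathbb R^N\to\mathbb R$ is weakly differentiable ($u$ and its weak gradient $\nabla u$ are in $L^1_{loc}(\mathbb R^N)$). Let $\mathcal P_1$ be the space of affine functions $x\mapsto c_0+(c,x)$ on $\mathbb R^N$, let $\dot H^s(\Omega)$ be the set of weakly differentiable $u$ with $D(u)<\infty$, and let $H^{s,0}_{g_1}(\Omega)$ be the set of $u\in\dot H^s(\Omega)$ such that, for every $\ell\in\mathcal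 P_1$, $u\ell$ is $\mu_{g_1}$-integrable and $\int_{\mathbb R^N} u\ell\,d\mu_{g_1}=0$. Define, with values in $[0,\infty]$, $$\lambda_1(g_1)=\inf_{u\in H^{s,0}_{g_1}(\Omega),\ u\neq 0}\frac{D(u)^2}{\int_{\mathbb R^N}u^2\,d\mu_{g_1}}$$ ($u\ne0$ means that $u$ does not vanish a.e.; a quotient with infinite denominator counts as $0$). Let $H^s_{\mathcal N}(\Omega)$ be the set of weakly differentiable $u$ with $$\|u\|^2_{H^s_{\mathcal N}(\Omega)}=\int_\Omega u^2\,dx+D(u)^2+\int_{\mathbb R^N\setminus\Omega}|g_1|u^2\,dx<\infty,$$ let $\mathcal H^s=H^s_{\mathcal N}(\Omega)/\mathcal P_1$ be its quotient by the relation $u\sim v$ iff $u=v+\ell$ a.e. for some $\ell\in\mathcal P_1$, and put $\|[u]\|_{\mathcal H^s}=\inf_{v\sim u}\|v\|_{H^s_{\mathcal N}(\Omega)}$ and $\|[u]\|_*=D(u)$. Then: 1. $\lambda_1(g_1)>0$. 2. (Equivalent form of 1.) There is a constant $C>0$, depending only on $N,\sigma,\Omega,g_1$, such that for every $v\in H^{s,0}_{g_1}(\Omega)$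 $$\int_\Omega v^2\,dx+\int_{\mathbb R^N\setminus\Omega}|g_1|v^2\,dx\le C\,D(v)^2.$$ 3. There is a constant $C>0$, depending only on $N,\sigma,\Omega,g_1$, such that for all $[u]\in\mathcal H^s$ $$\frac1C\,\|[u]\|_*\le\|[u]\|_{\mathcal H^s}\le C\,\|[u]\|_*.$$ -/

import Mathlib

open MeasureTheory Set
open scoped ENNReal ContDiff

namespace FracNeumann

/-- `ℝ^N` with its Euclidean norm. -/
abbrev RN (N : ℕ) : Type := EuclideanSpace ℝ (Fin N)

variable {N : ℕ}

/-- `U` is the weak gradient of `u` on `ℝ^N`: both are locally integrable and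
`∫ u ∂ⱼφ dx = - ∫ Uⱼ φ dx` for every test function `φ ∈ C_c^∞(ℝ^N)` and every `j`. -/
def HasWeakGradient (u : RN N → ℝ) (U : RN N → RN N) : Prop :=
  LocallyIntegrable u volume ∧ LocallyIntegrable U volume ∧
    ∀ φ : RN N → ℝ, ContDiff ℝ ∞ φ → HasCompactSupport φ → ∀ j : Fin N,
      ∫ x, u x * fderiv ℝ φ x (EuclideanSpace.single j 1) = -∫ x, U x j * φ x

/-- `u` is weakly differentiable on `ℝ^N`. -/
def WeaklyDifferentiable (u : RN N → ℝ) : Prop :=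
  ∃ U : RN N → RN N, HasWeakGradient u U

open Classical in
/-- The weak gradient `∇u` of a weakly differentiable function (determined up to a null set);
by convention `0` if `u` is not weakly differentiable. -/
noncomputable def weakGrad (u : RN N → ℝ) : RN N → RN N :=
  if h : WeaklyDifferentiable u then h.choose else 0

/-- `Q(Ω) = ℝ^{2N} \ (ℝ^N \ Ω)²`. -/
def QSet (Ω : Set (RN N)) : Set (RN N × RN N) := (Ωᶜ ×ˢ Ωᶜ)ᶜ

/-- `D(u)² = ∬_{Q(Ω)} |∇u(x) - ∇u(y)|² / |x - y|^{N + 2σ} dx dy`, with values in `[0, ∞]`. -/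
noncomputable def energy (Ω : Set (RN N)) (σ : ℝ) (u : RN N → ℝ) : ℝ≥0∞ :=
  ∫⁻ z in QSet Ω, ‖weakGrad u z.1 - weakGrad u z.2‖ₑ ^ 2 / ‖z.1 - z.2‖ₑ ^ ((N : ℝ) + 2 * σ)

/-- The affine functions `p(x) = c₀ + (c, x)`. -/
def Affine1 (N : ℕ) : Set (RN N → ℝ) :=
  {p | ∃ (c₀ : ℝ) (c : RN N), ∀ x, p x = c₀ + inner ℝ c x}

/-- The space `Ḣ^s(Ω)`, `s = 1 + σ`: weakly differentiable functions with `D(u) < ∞`. -/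
def HDot (Ω : Set (RN N)) (σ : ℝ) : Set (RN N → ℝ) :=
  {u | WeaklyDifferentiable u ∧ energy Ω σ u < ⊤}

/-- The measure `dμ_g = (χ_Ω + |g| χ_{ℝ^N \ Ω}) dx`. -/
noncomputable def muG (Ω : Set (RN N)) (g : RN N → ℝ) : Measure (RN N) :=
  volume.withDensity fun x => Ω.indicator 1 x + Ωᶜ.indicator (fun y => ‖g y‖ₑ) x

/-- `H^{s,0}_g(Ω)`: the functions `u ∈ Ḣ^s(Ω)` with `∫ u p dμ_g = 0` for all affine `p`, the
integrals being absolutely convergent. -/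
def HOrth (Ω : Set (RN N)) (σ : ℝ) (g : RN N → ℝ) : Set (RN N → ℝ) :=
  {u | u ∈ HDot Ω σ ∧ ∀ p ∈ Affine1 N,
    Integrable (fun x => u x * p x) (muG Ω g) ∧ ∫ x, u x * p x ∂(muG Ω g) = 0}

/-- The spectral value `λ₁(g) = inf D(u)² / ∫ u² dμ_g`, the infimum over the `u ∈ H^{s,0}_g(Ω)`
that do not vanish almost everywhere. It is taken in `[0, ∞]`, where a quotient with infinite
denominator is `0` and one with zero denominator and nonzero numerator is `∞`. -/
noncomputable def lambda1 (Ω : Set (RN N)) (σ : ℝ) (g : RN N → ℝ) : ℝ≥0∞ :=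
  ⨅ u ∈ {u | u ∈ HOrth Ω σ g ∧ ¬ u =ᵐ[volume] 0},
    energy Ω σ u / ∫⁻ x, ‖u x‖ₑ ^ 2 ∂(muG Ω g)

/-- `‖u‖² = ∫_Ω u² dx + D(u)² + ∫_{ℝ^N \ Ω} |g| u² dx`, with values in `[0, ∞]`. -/
noncomputable def normHsSq (Ω : Set (RN N)) (σ : ℝ) (g : RN N → ℝ) (u : RN N → ℝ) : ℝ≥0∞ :=
  (∫⁻ x in Ω, ‖u x‖ₑ ^ 2) + energy Ω σ u + ∫⁻ x in Ωᶜ, ‖g x‖ₑ * ‖u x‖ₑ ^ 2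

/-- The space `H^s_N(Ω)`, `s = 1 + σ`, with weight `g`: weakly differentiable functions of finite
norm. -/
def HsN (Ω : Set (RN N)) (σ : ℝ) (g : RN N → ℝ) : Type :=
  {u : RN N → ℝ // WeaklyDifferentiable u ∧ normHsSq Ω σ g u < ⊤}

/-- The norm of `H^s_N(Ω)`. -/
noncomputable def HsN.norm {Ω : Set (RN N)} {σ : ℝ} {g : RN N → ℝ} (u : HsN Ω σ g) : ℝ :=
  Real.sqrt (normHsSq Ω σ g u.1).toReal

/-- The seminorm `D(u)` on `H^s_N(Ω)`. -/
noncomputable def HsN.seminorm {Ω : Set (RN N)} {σ : ℝ} {g : RN N → ℝ} (u : HsN Ω σ g) : ℝ :=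
  Real.sqrt (energy Ω σ u.1).toReal

/-- `u ∼ v` iff `u = v + p` (almost everywhere) for some affine `p`. -/
def HsN.affineSetoid (Ω : Set (RN N)) (σ : ℝ) (g : RN N → ℝ) : Setoid (HsN Ω σ g) where
  r u v := ∃ p ∈ Affine1 N, u.1 =ᵐ[volume] fun x => v.1 x + p x
  iseqv :=
    { refl := fun u => ⟨fun _ => 0, ⟨0, 0, by simp⟩, by simp⟩
      symm := by
        rintro u v ⟨p, ⟨c₀, c, hp⟩, h⟩
        refine ⟨fun x => -p x, ⟨-c₀, -c, fun x => ?_⟩, ?_⟩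
        · simp only [hp, inner_neg_left]; ring
        · filter_upwards [h] with x hx
          rw [hx]; ring
      trans := by
        rintro u v w ⟨p, ⟨c₀, c, hp⟩, h⟩ ⟨q, ⟨d₀, d, hq⟩, k⟩
        refine ⟨fun x => q x + p x, ⟨d₀ + c₀, d + c, fun x => ?_⟩, ?_⟩
        · simp only [hp, hq, inner_add_left]; ring
        · filter_upwards [h, k] with x hx kx
          rw [hx, kx]; ring }

/-- The quotient `𝓗^s` of `H^s_N(Ω)` by the affine functions. -/
def HsQuot (Ω : Set (RN N)) (σ : ℝ) (g : RN N → ℝ) : Type :=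
  Quotient (HsN.affineSetoid Ω σ g)

/-- The class `[u]` of `u` in the quotient. -/
def HsQuot.mk {Ω : Set (RN N)} {σ : ℝ} {g : RN N → ℝ} (u : HsN Ω σ g) : HsQuot Ω σ g :=
  Quotient.mk (HsN.affineSetoid Ω σ g) u

/-- The quotient norm: the infimum of the norms of the representatives. -/
noncomputable def HsQuot.quotNorm {Ω : Set (RN N)} {σ : ℝ} {g : RN N → ℝ}
    (q : HsQuot Ω σ g) : ℝ :=
  sInf {r | ∃ v : HsN Ω σ g, HsQuot.mk v = q ∧ r = v.norm}

theorem weakGrad_spec {u : RN N → ℝ} (h : WeaklyDifferentiable u) :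
    HasWeakGradient u (weakGrad u) := by
  rw [weakGrad, dif_pos h]
  exact h.choose_spec

theorem HasWeakGradient.ae_unique {u : RN N → ℝ} {U V : RN N → RN N}
    (hU : HasWeakGradient u U) (hV : HasWeakGradient u V) : U =ᵐ[volume] V := by
  have key : ∀ j : Fin N, ∀ᵐ x ∂(volume : Measure (RN N)), U x j = V x j := by
    intro j
    have hproj : ∀ W : RN N → RN N, LocallyIntegrable W volume →
        LocallyIntegrable (fun x => W x j) volume := by
      intro W hW x
      obtain ⟨s, hs, hi⟩ := hW x
      exact ⟨s, hs, (EuclideanSpace.proj j : RN N →L[ℝ] ℝ).integrable_comp hi⟩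
    refine ae_eq_of_integral_contDiff_smul_eq (hproj U hU.2.1) (hproj V hV.2.1) ?_
    intro φ hφ hc
    have h1 := hU.2.2 φ hφ hc j
    have h2 := hV.2.2 φ hφ hc j
    have h3 : ∫ x, U x j * φ x = ∫ x, V x j * φ x := by linarith
    simpa only [smul_eq_mul, mul_comm] using h3
  filter_upwards [ae_all_iff.2 key] with x hx
  ext j
  exact hx j

theorem HasWeakGradient.congr {u v : RN N → ℝ} {U : RN N → RN N}
    (hU : HasWeakGradient u U) (h : u =ᵐ[volume] v) : HasWeakGradient v U := by
  refine ⟨?_, hU.2.1, ?_⟩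
  · intro x
    obtain ⟨s, hs, hi⟩ := hU.1 x
    exact ⟨s, hs, hi.congr_fun_ae (ae_restrict_of_ae h)⟩
  · intro φ hφ hc j
    rw [← hU.2.2 φ hφ hc j]
    refine integral_congr_ae ?_
    filter_upwards [h] with x hx
    rw [hx]

/-- Adding an affine function `c₀ + (c, x)` adds the constant `c` to the weak gradient. -/
theorem HasWeakGradient.add_affine {u p : RN N → ℝ} {U : RN N → RN N}
    (hU : HasWeakGradient u U) {c₀ : ℝ} {c : RN N} (hp : ∀ x, p x = c₀ + inner ℝ c x) :
    HasWeakGradient (fun x => u x + p x) (fun x => U x + c) := by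
  obtain rfl : p = fun x => c₀ + inner ℝ c x := funext hp
  have hpc : Continuous fun x : RN N => c₀ + inner ℝ c x := by fun_prop
  refine ⟨hU.1.add hpc.locallyIntegrable, hU.2.1.add (locallyIntegrable_const c), ?_⟩
  intro φ hφ hc j
  set e : RN N := EuclideanSpace.single j 1
  have hφc : Continuous φ := hφ.continuous
  have hdc : Continuous fun x => fderiv ℝ φ x e :=
    (hφ.continuous_fderiv (by simp)).clm_apply continuous_const
  have hds : HasCompactSupport fun x => fderiv ℝ φ x e := hc.fderiv_apply ℝ e
  have i1 : Integrable fun x => u x * fderiv ℝ φ x e := by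
    have := hU.1.integrable_smul_left_of_hasCompactSupport hdc hds
    simpa only [smul_eq_mul, mul_comm] using this
  have i2 : Integrable fun x => (c₀ + inner ℝ c x) * fderiv ℝ φ x e :=
    (hpc.mul hdc).integrable_of_hasCompactSupport hds.mul_left
  have i3 : Integrable fun x => U x j * φ x := by
    have := hU.2.1.integrable_smul_left_of_hasCompactSupport hφc hc
    have h2 := (EuclideanSpace.proj j : RN N →L[ℝ] ℝ).integrable_comp this
    simpa [mul_comm] using h2
  have i4 : Integrable fun x => c j * φ x :=
    (hφc.integrable_of_hasCompactSupport hc).const_mul _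
  have i5 : Integrable fun x => (c₀ + inner ℝ c x) * φ x :=
    (hpc.mul hφc).integrable_of_hasCompactSupport hc.mul_left
  have hder : ∀ x : RN N, HasFDerivAt (fun x : RN N => c₀ + inner ℝ c x) (innerSL ℝ c) x := by
    intro x
    exact (innerSL ℝ c).hasFDerivAt.const_add c₀
  have hfd : ∀ x : RN N, fderiv ℝ (fun x : RN N => c₀ + inner ℝ c x) x e = c j := by
    intro x
    rw [(hder x).fderiv]
    simp [e, EuclideanSpace.inner_single_right]
  have ibp : ∫ x, (c₀ + inner ℝ c x) * fderiv ℝ φ x e = -∫ x, c j * φ x := by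
    have := integral_mul_fderiv_eq_neg_fderiv_mul_of_integrable (μ := (volume : Measure (RN N)))
      (f := fun x : RN N => c₀ + inner ℝ c x) (g := φ) (v := e)
      (by simpa only [hfd] using i4) i2 i5
      (fun x _ => (hder x).differentiableAt)
      (fun x _ => (hφ.differentiable (by simp)) x)
    simpa only [hfd] using this
  calc ∫ x, (u x + (c₀ + inner ℝ c x)) * fderiv ℝ φ x e
      = (∫ x, u x * fderiv ℝ φ x e) + ∫ x, (c₀ + inner ℝ c x) * fderiv ℝ φ x e := by
        rw [← integral_add i1 i2]; simp only [add_mul]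
    _ = -∫ x, (U x + c) j * φ x := by
        rw [hU.2.2 φ hφ hc j, ibp, ← neg_add, ← integral_add i3 i4]
        simp only [PiLp.add_apply, add_mul]

/-- `D` is invariant under the addition of affine functions and under changes on null sets. -/
theorem energy_eq_of_affine {Ω : Set (RN N)} {σ : ℝ} {u v : RN N → ℝ}
    (hu : WeaklyDifferentiable u) (hv : WeaklyDifferentiable v)
    (h : ∃ p ∈ Affine1 N, u =ᵐ[volume] fun x => v x + p x) :
    energy Ω σ u = energy Ω σ v := by
  obtain ⟨p, ⟨c₀, c, hp⟩, hup⟩ := h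
  have hae : weakGrad u =ᵐ[volume] fun x => weakGrad v x + c :=
    (weakGrad_spec hu).ae_unique (((weakGrad_spec hv).add_affine hp).congr hup.symm)
  have h1 : ∀ᵐ z ∂(volume : Measure (RN N × RN N)), weakGrad u z.1 = weakGrad v z.1 + c :=
    Measure.quasiMeasurePreserving_fst.ae hae
  have h2 : ∀ᵐ z ∂(volume : Measure (RN N × RN N)), weakGrad u z.2 = weakGrad v z.2 + c :=
    Measure.quasiMeasurePreserving_snd.ae hae
  refine lintegral_congr_ae (ae_restrict_of_ae ?_)
  filter_upwards [h1, h2] with z hz1 hz2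
  rw [hz1, hz2, add_sub_add_right_eq_sub]

/-- The norm `‖[u]‖_* = D(u)` on the quotient. -/
noncomputable def HsQuot.starNorm {Ω : Set (RN N)} {σ : ℝ} {g : RN N → ℝ} :
    HsQuot Ω σ g → ℝ :=
  Quotient.lift HsN.seminorm fun u v h => by
    rw [HsN.seminorm, HsN.seminorm, energy_eq_of_affine u.2.1 v.2.1 h]

end FracNeumann

namespace FracNeumann

variable {N : ℕ}

/-! All three assertions follow from a Poincaré inequality modulo affine functions,
`exists_affine_lintegral_muG_le`: each weakly differentiable u has an affine ℓ with ∫ |u - ℓ|² dμ_g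
≤ C D(u)². It is proved directly, without compactness.

The linear part c of ℓ is a value ∇u(x) at a well-chosen x ∈ Ω. Since Ω × B ⊆ Q(Ω) and the singular
kernel is bounded below on bounded sets, averaging over x bounds ∇u - c in L²(B) by D(u). The
constant part comes from a weighted Poincaré inequality on a ball for u - (c, x). Integrating along
segments produces the kernel |x - y|^(-β), where convergence of the t-integrals needs β > N - 2,
while Hölder against an L^p weight needs β < N - N/p. The two are compatible exactly when p > N/2.

If v is orthogonal to the affine functions, Pythagoras gives ‖v‖ ≤ ‖v - ℓ‖ in L²(μ_g), hence the
inequality for v and the bound on λ₁. For the quotient norm, u - ℓ is a good representative of [u].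
-/

/-! ### Integral estimates and the kernel bound -/

theorem sq_lintegral_mul_le {α : Type*} [MeasurableSpace α] {μ : Measure α} {f g : α → ℝ≥0∞}
    (hf : AEMeasurable f μ) (hg : AEMeasurable g μ) :
    (∫⁻ a, f a * g a ∂μ) ^ 2 ≤ (∫⁻ a, f a ^ 2 ∂μ) * ∫⁻ a, g a ^ 2 ∂μ := by
  have h := ENNReal.lintegral_mul_le_Lp_mul_Lq μ Real.HolderConjugate.two_two hf hg
  simp only [Pi.mul_apply, ENNReal.rpow_ofNat] at h
  calc (∫⁻ a, f a * g a ∂μ) ^ 2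
      ≤ ((∫⁻ a, f a ^ 2 ∂μ) ^ (1 / 2 : ℝ) * (∫⁻ a, g a ^ 2 ∂μ) ^ (1 / 2 : ℝ)) ^ 2 := by gcongr
    _ = _ := by
      rw [mul_pow, ← ENNReal.rpow_natCast, ← ENNReal.rpow_natCast, ← ENNReal.rpow_mul,
        ← ENNReal.rpow_mul]
      norm_num

theorem lintegral_Ioc_ofReal_rpow_lt_top {b : ℝ} (hb : -1 < b) :
    ∫⁻ t in Ioc (0 : ℝ) 1, ENNReal.ofReal t ^ b < ⊤ := by
  have h := (intervalIntegral.intervalIntegrable_rpow' (a := 0) (b := 1) hb).1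
  refine lt_of_eq_of_lt ?_ h.2
  refine setLIntegral_congr_fun measurableSet_Ioc fun t ht => ?_
  dsimp only
  rw [ENNReal.ofReal_rpow_of_pos ht.1, ← ofReal_norm,
    Real.norm_of_nonneg (Real.rpow_nonneg ht.1.le _)]

/-- In polar coordinates the integrand becomes r^(N-1-γ), whose exponent exceeds -1. -/
theorem lintegral_ball_enorm_rpow_lt_top (hN : 1 ≤ N) {γ : ℝ} (hγ : γ < N) (R : ℝ) :
    ∫⁻ z in Metric.ball (0 : RN N) R, ‖z‖ₑ ^ (-γ) < ⊤ := by
  have : Nonempty (Fin N) := ⟨⟨0, hN⟩⟩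
  have : Nontrivial (RN N) := inferInstance
  have h : IntegrableOn (fun z : RN N => ‖z‖ ^ (-γ)) (Metric.ball 0 R) volume := by
    rw [integrableOn_fun_norm_addHaar (μ := (volume : Measure (RN N))) (f := fun t => t ^ (-γ))]
    rcases le_or_gt R 0 with hR | hR
    · rw [Ioo_eq_empty (by simpa using hR)]; exact integrableOn_empty
    have h1 := (intervalIntegral.intervalIntegrable_rpow' (a := 0) (b := R)
      (r := (N : ℝ) - 1 - γ) (by linarith)).1
    refine (h1.mono_set Ioo_subset_Ioc_self).congr_fun (fun t ht => ?_) measurableSet_Ioo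
    simp only [finrank_euclideanSpace, Fintype.card_fin, smul_eq_mul]
    rw [← Real.rpow_natCast, ← Real.rpow_add ht.1, Nat.cast_sub hN]
    congr 1; push_cast; ring
  refine lt_of_eq_of_lt (lintegral_congr_ae (ae_restrict_of_ae ?_)) h.2
  have : ∀ᵐ z : RN N, z ≠ 0 := by
    simp [ae_iff]
  filter_upwards [this] with z hz
  have hz' : 0 < ‖z‖ := norm_pos_iff.2 hz
  rw [← ofReal_norm, ENNReal.ofReal_rpow_of_pos hz', ← ofReal_norm,
    Real.norm_of_nonneg (Real.rpow_nonneg hz'.le _)]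

/-- Change of variables `y = x + t (z - x)`. -/
theorem lintegral_comp_add_smul_sub (x : RN N) {t : ℝ} (ht : 0 < t) {H : RN N → ℝ≥0∞}
    (hH : Measurable H) :
    ∫⁻ z, H (x + t • (z - x)) = ENNReal.ofReal t ^ (-(N : ℝ)) * ∫⁻ y, H y := by
  have h1 : ∫⁻ z, H (x + t • (z - x)) = ∫⁻ z, H (x + t • z) :=
    lintegral_sub_right_eq_self (fun z => H (x + t • z)) x
  have h2 : ∫⁻ z, H (x + t • z) =
      ∫⁻ z, H (x + z) ∂(Measure.map (t • ·) (volume : Measure (RN N))) := by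
    rw [lintegral_map (by fun_prop) (by fun_prop)]
  rw [h1, h2, Measure.map_addHaar_smul _ ht.ne', lintegral_smul_measure, lintegral_add_left_eq_self,
    smul_eq_mul, finrank_euclideanSpace, Fintype.card_fin, abs_of_pos (by positivity),
    ENNReal.ofReal_inv_of_pos (by positivity), ENNReal.rpow_neg, ENNReal.rpow_natCast,
    ENNReal.ofReal_pow ht.le]

/-- Kernel bound: `‖x - y‖ ^ (-β)` is uniformly integrable against an `L^p` weight, `p > N / 2`, for
some `β > N - 2`. -/
theorem exists_rpow_kernel_bound (hN : 1 ≤ N) {p : ℝ≥0∞} (hp1 : 1 ≤ p) (hpN : (N : ℝ≥0∞) / 2 < p)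
    {R : ℝ} {h : RN N → ℝ} (hh : MemLp h p (volume.restrict (Metric.ball 0 R))) :
    ∃ β : ℝ, 0 ≤ β ∧ (N : ℝ) - 2 < β ∧ ∃ M : ℝ≥0∞, M ≠ ⊤ ∧ ∀ y ∈ Metric.ball (0 : RN N) R,
      ∫⁻ x in Metric.ball 0 R, ‖h x‖ₑ * ‖x - y‖ₑ ^ (-β) ≤ M := by
  have : IsFiniteMeasure (volume.restrict (Metric.ball (0 : RN N) R)) :=
    ⟨by simpa using measure_ball_lt_top⟩
  rcases hN.eq_or_lt with rfl | hN2
  -- For N = 1 the exponent β = 0 already exceeds N - 2, and the kernel disappears.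
  · refine ⟨0, le_rfl, by norm_num, _, (hh.integrable hp1).2.ne, fun y _ => ?_⟩
    simp
  have hN2' : (2 : ℝ) ≤ N := by exact_mod_cast hN2
  -- A finite exponent q ≤ p, still above N/2 ≥ 1, makes Hölder conjugation available; it covers p =
  -- ∞ as well.
  obtain ⟨q, hq1, hqN, hqp⟩ : ∃ q : ℝ, 1 < q ∧ (N : ℝ) / 2 < q ∧ ENNReal.ofReal q ≤ p := by
    by_cases hp : p = ⊤
    · exact ⟨N, by linarith, by linarith, by simp [hp]⟩
    · have h2 : (N : ℝ) / 2 < p.toReal := by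
        have := (ENNReal.toReal_lt_toReal (by finiteness) hp).2 hpN
        simpa using this
      exact ⟨p.toReal, by linarith, h2, by rw [ENNReal.ofReal_toReal hp]⟩
  have hq0 : 0 < q := by linarith
  have hNq : (N : ℝ) / q < 2 := by rw [div_lt_iff₀ hq0]; linarith
  have hpq : q.HolderConjugate (q / (q - 1)) := Real.HolderConjugate.conjExponent hq1
  set q' := q / (q - 1) with hq'
  have hq'0 : 0 < q' := by rw [hq']; exact div_pos hq0 (by linarith)
  -- The interval is nonempty because N/q < 2; its upper end N - N/q = N/q' is what makes |z|^(-βq')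
  -- locally integrable.
  obtain ⟨β, hβ1, hβ2⟩ := exists_between (show (N : ℝ) - 2 < N - N / q by linarith)
  have hβq : β * q' < N := by
    have : (N : ℝ) - N / q = N / q' := by
      rw [hq']; field_simp
    rw [this] at hβ2
    exact (lt_div_iff₀ hq'0).1 hβ2
  have hhq := hh.mono_exponent hqp
  refine ⟨β, by linarith, hβ1, (∫⁻ x in Metric.ball 0 R, ‖h x‖ₑ ^ q) ^ (1 / q) *
    (∫⁻ z in Metric.ball (0 : RN N) (R + R), ‖z‖ₑ ^ (-(β * q'))) ^ (1 / q'), ?_, fun y hy => ?_⟩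
  · refine ENNReal.mul_ne_top ?_ ?_
    · have := lintegral_rpow_enorm_lt_top_of_eLpNorm_lt_top (by simpa using hq0)
        ENNReal.ofReal_ne_top hhq.2
      rw [ENNReal.toReal_ofReal hq0.le] at this
      exact (ENNReal.rpow_lt_top_of_nonneg (by positivity) this.ne).ne
    · exact (ENNReal.rpow_lt_top_of_nonneg (by positivity)
        (lintegral_ball_enorm_rpow_lt_top hN hβq _).ne).ne
  · have hk : Measurable fun x : RN N => ‖x - y‖ₑ ^ (-β) := by fun_prop
    refine (ENNReal.lintegral_mul_le_Lp_mul_Lq _ hpq hh.1.enorm hk.aemeasurable).trans ?_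
    refine mul_le_mul' le_rfl (ENNReal.rpow_le_rpow ?_ (by positivity))
    calc ∫⁻ x in Metric.ball 0 R, (‖x - y‖ₑ ^ (-β)) ^ q'
        = ∫⁻ x, (Metric.ball 0 R).indicator (fun x => ‖x - y‖ₑ ^ (-(β * q'))) x := by
          rw [lintegral_indicator Metric.isOpen_ball.measurableSet]
          simp only [← ENNReal.rpow_mul, neg_mul]
      _ ≤ ∫⁻ x, (Metric.ball 0 (R + R)).indicator (fun z => ‖z‖ₑ ^ (-(β * q'))) (x - y) := by
          refine lintegral_mono fun x => ?_
          by_cases hx : x ∈ Metric.ball (0 : RN N) R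
          · have : x - y ∈ Metric.ball (0 : RN N) (R + R) := by
              rw [mem_ball_zero_iff] at *
              exact (norm_sub_le x y).trans_lt (add_lt_add hx hy)
            rw [indicator_of_mem hx, indicator_of_mem this]
          · rw [indicator_of_notMem hx]; exact zero_le
      _ = _ := by
          rw [lintegral_sub_right_eq_self (fun x => (Metric.ball 0 (R + R)).indicator
            (fun z : RN N => ‖z‖ₑ ^ (-(β * q'))) x) y,
            lintegral_indicator Metric.isOpen_ball.measurableSet]

/-! ### Weighted Poincaré inequality for C¹ functions -/

/-- Weighted fundamental theorem of calculus along a segment. -/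
theorem enorm_sub_sq_le_lintegral_segment {u : RN N → ℝ} (hu : ContDiff ℝ 1 u) (a : ℝ)
    (x z : RN N) :
    ‖u x - u z‖ₑ ^ 2 ≤ ‖z - x‖ₑ ^ 2 * ((∫⁻ t in Ioc (0 : ℝ) 1, ENNReal.ofReal t ^ (-a)) *
      ∫⁻ t in Ioc (0 : ℝ) 1, ENNReal.ofReal t ^ a * ‖fderiv ℝ u (x + t • (z - x))‖ₑ ^ 2) := by
  have hc : Continuous (fderiv ℝ u) := hu.continuous_fderiv one_ne_zero
  have hder : ∀ t : ℝ, HasDerivAt (fun t : ℝ => u (x + t • (z - x)))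
      (fderiv ℝ u (x + t • (z - x)) (z - x)) t := fun t => by
    have h1 : HasDerivAt (fun t : ℝ => x + t • (z - x)) (z - x) t := by
      simpa using ((hasDerivAt_id t).smul_const (z - x)).const_add x
    exact ((hu.differentiable one_ne_zero _).hasFDerivAt).comp_hasDerivAt t h1
  have hcd : Continuous fun t : ℝ => fderiv ℝ u (x + t • (z - x)) (z - x) := by fun_prop
  have hint := intervalIntegral.integral_eq_sub_of_hasDerivAt (a := 0) (b := 1)
    (fun t _ => hder t) (hcd.intervalIntegrable _ _)
  simp only [one_smul, zero_smul, add_zero, add_sub_cancel] at hint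
  have h1 : ‖u x - u z‖ₑ ≤
      ‖z - x‖ₑ * ∫⁻ t in Ioc (0 : ℝ) 1, ‖fderiv ℝ u (x + t • (z - x))‖ₑ := by
    rw [← enorm_neg, neg_sub, ← hint, intervalIntegral.integral_of_le zero_le_one]
    refine (enorm_integral_le_lintegral_enorm _).trans ?_
    rw [← lintegral_const_mul _ (by fun_prop)]
    refine lintegral_mono fun t => ?_
    rw [mul_comm]
    exact ContinuousLinearMap.le_opENorm _ _
  calc ‖u x - u z‖ₑ ^ 2
      ≤ (‖z - x‖ₑ * ∫⁻ t in Ioc (0 : ℝ) 1, ‖fderiv ℝ u (x + t • (z - x))‖ₑ) ^ 2 := by gcongr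
    -- The factor 1 = t^(-a/2) t^(a/2) is inserted before Cauchy–Schwarz; the free exponent a later
    -- offsets the Jacobian t^(-N).
    _ = ‖z - x‖ₑ ^ 2 * (∫⁻ t in Ioc (0 : ℝ) 1, ENNReal.ofReal t ^ (-a / 2) *
          (ENNReal.ofReal t ^ (a / 2) * ‖fderiv ℝ u (x + t • (z - x))‖ₑ)) ^ 2 := by
        rw [mul_pow]
        congr 2
        refine setLIntegral_congr_fun measurableSet_Ioc fun t ht => ?_
        rw [← mul_assoc, ← ENNReal.rpow_add _ _ (by simpa using ht.1) ENNReal.ofReal_ne_top]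
        simp [neg_div]
    _ ≤ _ := by
        gcongr
        refine (sq_lintegral_mul_le (by fun_prop) (by fun_prop)).trans (le_of_eq ?_)
        simp only [mul_pow, ← ENNReal.rpow_natCast, ← ENNReal.rpow_mul]
        norm_num

/-- Averaging over the end point of the segment produces a Riesz-type kernel. -/
theorem lintegral_ball_segment_le {F : RN N → ℝ≥0∞} (hF : Measurable F) {R β t : ℝ}
    (hβ : 0 ≤ β) (ht : t ∈ Ioc (0 : ℝ) 1) {x : RN N} (hx : x ∈ Metric.ball (0 : RN N) R) :
    ∫⁻ z in Metric.ball 0 R, F (x + t • (z - x)) ≤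
      ENNReal.ofReal (2 * R) ^ β * (ENNReal.ofReal t ^ (β - N) *
        ∫⁻ y in Metric.ball 0 R, F y * ‖x - y‖ₑ ^ (-β)) := by
  have hR : 0 < R := (norm_nonneg x).trans_lt (by simpa using hx)
  have htt : ENNReal.ofReal t ≠ 0 := by simpa using ht.1
  -- The point y = x + t(z - x) satisfies |x - y| ≤ 2Rt, so the factor (2Rt/|x - y|)^β is at least
  -- 1. Inserting it gains t^β against the Jacobian, at the price of the kernel.
  set H : RN N → ℝ≥0∞ := fun y => (Metric.ball 0 R).indicator F y *
    (ENNReal.ofReal (2 * R) ^ β * ENNReal.ofReal t ^ β * ‖x - y‖ₑ ^ (-β)) with hH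
  have hHm : Measurable H := by
    have := hF.indicator (Metric.isOpen_ball (x := (0 : RN N)) (ε := R)).measurableSet
    fun_prop
  calc ∫⁻ z in Metric.ball 0 R, F (x + t • (z - x))
      ≤ ∫⁻ z in Metric.ball 0 R, H (x + t • (z - x)) := by
        refine setLIntegral_mono (by fun_prop) fun z hz => ?_
        have hmem : x + t • (z - x) ∈ Metric.ball (0 : RN N) R :=
          (convex_ball (0 : RN N) R).add_smul_sub_mem hx hz ⟨ht.1.le, ht.2⟩
        have hzx : ‖z - x‖ₑ ≤ ENNReal.ofReal (2 * R) := by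
          rw [← ofReal_norm]
          refine ENNReal.ofReal_le_ofReal ((norm_sub_le z x).trans ?_)
          rw [mem_ball_zero_iff] at hx hz
          linarith
        simp only [hH, indicator_of_mem hmem]
        refine le_mul_of_one_le_right' ?_
        rw [sub_add_cancel_left, enorm_neg, enorm_smul, ENNReal.rpow_neg, ← div_eq_mul_inv,
          ← ENNReal.mul_rpow_of_nonneg _ _ hβ, ← ENNReal.div_rpow_of_nonneg _ _ hβ]
        refine (ENNReal.one_rpow β).ge.trans (ENNReal.rpow_le_rpow ?_ hβ)
        have hDt : ENNReal.ofReal (2 * R) * ENNReal.ofReal t ≠ 0 := by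
          simp [hR, ht.1]
        rw [ENNReal.le_div_iff_mul_le (Or.inr hDt) (Or.inr (by finiteness)), one_mul,
          Real.enorm_of_nonneg ht.1.le, mul_comm]
        gcongr
    _ ≤ ∫⁻ z, H (x + t • (z - x)) := setLIntegral_le_lintegral _ _
    _ = ENNReal.ofReal t ^ (-(N : ℝ)) * ∫⁻ y, H y := lintegral_comp_add_smul_sub x ht.1 hHm
    _ = ENNReal.ofReal t ^ (-(N : ℝ)) * (ENNReal.ofReal (2 * R) ^ β * ENNReal.ofReal t ^ β *
          ∫⁻ y in Metric.ball 0 R, F y * ‖x - y‖ₑ ^ (-β)) := by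
        congr 1
        rw [← lintegral_const_mul _ (by fun_prop),
          ← lintegral_indicator Metric.isOpen_ball.measurableSet]
        refine lintegral_congr fun y => ?_
        by_cases hy : y ∈ Metric.ball (0 : RN N) R
        · simp only [hH, indicator_of_mem hy]; ring
        · simp only [hH, indicator_of_notMem hy, zero_mul]
    _ = _ := by
        rw [sub_eq_neg_add, ENNReal.rpow_add _ _ htt ENNReal.ofReal_ne_top]
        ring

/-- Weighted Poincaré inequality on a ball for `C¹` functions, in double integral form. -/
theorem lintegral_lintegral_sub_sq_le_of_contDiff {β R : ℝ} (hβ : 0 ≤ β)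
    (hβN : (N : ℝ) - 2 < β) {G : RN N → ℝ≥0∞}
    (hG : AEMeasurable G (volume.restrict (Metric.ball 0 R))) {M : ℝ≥0∞} (hM : M ≠ ⊤)
    (hGM : ∀ y ∈ Metric.ball (0 : RN N) R,
      ∫⁻ x in Metric.ball 0 R, G x * ‖x - y‖ₑ ^ (-β) ≤ M) :
    ∃ C : ℝ≥0∞, C ≠ ⊤ ∧ ∀ u : RN N → ℝ, ContDiff ℝ 1 u →
      ∫⁻ x in Metric.ball 0 R, ∫⁻ z in Metric.ball 0 R, G x * ‖u x - u z‖ₑ ^ 2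
        ≤ C * ∫⁻ y in Metric.ball 0 R, ‖fderiv ℝ u y‖ₑ ^ 2 := by
  -- Integrability at 0 of t^(-a) requires a < 1, that of t^(a+β-N) requires a > N - 1 - β; such an
  -- a exists because β > N - 2.
  obtain ⟨a, ha1, ha2⟩ := exists_between (show (N : ℝ) - 1 - β < 1 by linarith)
  have hIa : ∫⁻ t in Ioc (0 : ℝ) 1, ENNReal.ofReal t ^ (-a) < ⊤ :=
    lintegral_Ioc_ofReal_rpow_lt_top (by linarith)
  have hIb : ∫⁻ t in Ioc (0 : ℝ) 1, ENNReal.ofReal t ^ (a + (β - N)) < ⊤ :=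
    lintegral_Ioc_ofReal_rpow_lt_top (by linarith)
  set Ia := ∫⁻ t in Ioc (0 : ℝ) 1, ENNReal.ofReal t ^ (-a)
  set Ib := ∫⁻ t in Ioc (0 : ℝ) 1, ENNReal.ofReal t ^ (a + (β - N))
  set B := Metric.ball (0 : RN N) R with hB
  set D := ENNReal.ofReal (2 * R) with hD
  have hBm : MeasurableSet B := Metric.isOpen_ball.measurableSet
  have hDIa : D ^ 2 * Ia ≠ ⊤ := ENNReal.mul_ne_top (ENNReal.pow_ne_top ENNReal.ofReal_ne_top) hIa.ne
  have hfin : D ^ 2 * Ia * (D ^ β * Ib) ≠ ⊤ := ENNReal.mul_ne_top hDIa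
    (ENNReal.mul_ne_top (ENNReal.rpow_lt_top_of_nonneg hβ ENNReal.ofReal_ne_top).ne hIb.ne)
  refine ⟨D ^ 2 * Ia * (D ^ β * Ib) * M, ENNReal.mul_ne_top hfin hM, fun u hu => ?_⟩
  have hc : Continuous (fderiv ℝ u) := hu.continuous_fderiv one_ne_zero
  set F : RN N → ℝ≥0∞ := fun y => ‖fderiv ℝ u y‖ₑ ^ 2 with hF
  have hFm : Measurable F := by fun_prop
  have hinner : ∀ x ∈ B, ∫⁻ z in B, ‖u x - u z‖ₑ ^ 2 ≤
      D ^ 2 * Ia * (D ^ β * Ib) * ∫⁻ y in B, F y * ‖x - y‖ₑ ^ (-β) := by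
    intro x hx
    calc ∫⁻ z in B, ‖u x - u z‖ₑ ^ 2
        ≤ ∫⁻ z in B, D ^ 2 * Ia *
            ∫⁻ t in Ioc (0 : ℝ) 1, ENNReal.ofReal t ^ a * F (x + t • (z - x)) := by
          refine setLIntegral_mono' hBm fun z hz => ?_
          have hzx : ‖z - x‖ₑ ≤ D := by
            rw [← ofReal_norm]
            refine ENNReal.ofReal_le_ofReal ((norm_sub_le z x).trans ?_)
            rw [hB, mem_ball_zero_iff] at hx hz
            linarith
          refine (enorm_sub_sq_le_lintegral_segment hu a x z).trans ?_
          rw [mul_assoc]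
          gcongr
      _ = D ^ 2 * Ia * ∫⁻ t in Ioc (0 : ℝ) 1, ENNReal.ofReal t ^ a *
            ∫⁻ z in B, F (x + t • (z - x)) := by
          rw [lintegral_const_mul' _ _ hDIa,
            lintegral_lintegral_swap (by
              refine Measurable.aemeasurable ?_
              unfold Function.uncurry
              fun_prop)]
          congr 1
          refine lintegral_congr fun t => ?_
          rw [lintegral_const_mul _ (by fun_prop)]
      _ ≤ D ^ 2 * Ia * ∫⁻ t in Ioc (0 : ℝ) 1, D ^ β * (∫⁻ y in B, F y * ‖x - y‖ₑ ^ (-β)) *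
            ENNReal.ofReal t ^ (a + (β - N)) := by
          gcongr 1
          refine setLIntegral_mono' measurableSet_Ioc fun t ht => ?_
          refine (mul_le_mul' le_rfl (lintegral_ball_segment_le hFm hβ ht hx)).trans (le_of_eq ?_)
          rw [ENNReal.rpow_add a _ (by simpa using ht.1) ENNReal.ofReal_ne_top]
          ring
      _ = _ := by
          rw [lintegral_const_mul _ (by fun_prop)]
          ring
  calc ∫⁻ x in B, ∫⁻ z in B, G x * ‖u x - u z‖ₑ ^ 2
      = ∫⁻ x in B, G x * ∫⁻ z in B, ‖u x - u z‖ₑ ^ 2 := by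
        refine lintegral_congr fun x => ?_
        have := hu.continuous
        rw [lintegral_const_mul _ (by fun_prop)]
    _ ≤ ∫⁻ x in B, D ^ 2 * Ia * (D ^ β * Ib) * ∫⁻ y in B, F y * (G x * ‖x - y‖ₑ ^ (-β)) := by
        refine setLIntegral_mono' hBm fun x hx => ?_
        refine (mul_le_mul' le_rfl (hinner x hx)).trans (le_of_eq ?_)
        rw [mul_left_comm]
        congr 1
        rw [← lintegral_const_mul _ (by fun_prop)]
        simp only [mul_left_comm (G x)]
    -- Fubini brings the weight and the kernel together, where the bound M is uniform in y.
    _ = D ^ 2 * Ia * (D ^ β * Ib) * ∫⁻ y in B, F y * ∫⁻ x in B, G x * ‖x - y‖ₑ ^ (-β) := by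
        rw [lintegral_const_mul' _ _ hfin, lintegral_lintegral_swap]
        · congr 1
          refine lintegral_congr fun y => ?_
          rw [lintegral_const_mul'']
          exact hG.mul (by fun_prop)
        · unfold Function.uncurry
          have := hG.comp_fst (ν := volume.restrict B)
          fun_prop
    _ ≤ D ^ 2 * Ia * (D ^ β * Ib) * ∫⁻ y in B, F y * M := by
        gcongr 1
        refine setLIntegral_mono' hBm fun y hy => ?_
        gcongr
        exact hGM y hy
    _ = _ := by
        rw [lintegral_mul_const _ hFm]
        ring

/-! ### Mollification and passage to weakly differentiable functions -/

open ContinuousLinearMap Convolution in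
/-- The gradient of a mollification is the mollification of the weak gradient. -/
theorem HasWeakGradient.fderiv_convolution {w : RN N → ℝ} {U : RN N → RN N}
    (h : HasWeakGradient w U) {φ : RN N → ℝ} (hφ : ContDiff ℝ ∞ φ) (hc : HasCompactSupport φ)
    (x : RN N) :
    fderiv ℝ (w ⋆[lsmul ℝ ℝ] φ) x = innerSL ℝ (∫ t, φ (x - t) • U t) := by
  have hφ1 : ContDiff ℝ 1 φ := hφ.of_le (by exact_mod_cast le_top)
  have hcont : Continuous fun t => φ (x - t) := by have := hφ.continuous; fun_prop
  have hcs : HasCompactSupport fun t => φ (x - t) :=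
    hc.comp_homeomorph (Homeomorph.subLeft x)
  have hint : Integrable fun t => φ (x - t) • U t :=
    h.2.1.integrable_smul_left_of_hasCompactSupport hcont hcs
  rw [(hc.hasFDerivAt_convolution_right _ h.1 hφ1 x).fderiv]
  refine ContinuousLinearMap.coe_injective
    ((EuclideanSpace.basisFun (Fin N) ℝ).toBasis.ext fun j => ?_)
  simp only [OrthonormalBasis.coe_toBasis, EuclideanSpace.basisFun_apply, coe_coe,
    innerSL_apply_apply]
  have hfc : Continuous (fderiv ℝ φ) := hφ.continuous_fderiv (by simp)
  rw [convolution_precompR_apply _ h.1 (hc.fderiv ℝ) hfc, convolution_def]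
  -- The reflected kernel t ↦ φ(x - t) is the test function; the sign from the chain rule cancels
  -- the one in the definition of the weak gradient.
  have hψ := h.2.2 (fun t => φ (x - t)) (by fun_prop) hcs j
  have hfd : ∀ t, fderiv ℝ (fun t => φ (x - t)) t (EuclideanSpace.single j 1) =
      -fderiv ℝ φ (x - t) (EuclideanSpace.single j 1) := by
    intro t
    have h1 : HasFDerivAt (fun t : RN N => x - t) (-ContinuousLinearMap.id ℝ (RN N)) t :=
      (hasFDerivAt_id t).const_sub x
    have h2 := ((hφ1.differentiable one_ne_zero (x - t)).hasFDerivAt).comp t h1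
    rw [show (fun t => φ (x - t)) = φ ∘ fun t => x - t from rfl, h2.fderiv]
    simp
  simp only [hfd, mul_neg, integral_neg, neg_inj] at hψ
  simp only [lsmul_apply, smul_eq_mul]
  rw [hψ]
  have := (EuclideanSpace.proj j : RN N →L[ℝ] ℝ).integral_comp_comm hint
  simp only [PiLp.proj_apply, PiLp.smul_apply, smul_eq_mul] at this
  simp [EuclideanSpace.inner_single_right, ← this, mul_comm]

open ContinuousLinearMap Convolution in
/-- Mollification with a kernel supported in the unit ball decreases the Dirichlet integral, up to
enlarging the domain. -/
theorem HasWeakGradient.lintegral_fderiv_convolution_le {w : RN N → ℝ} {U : RN N → RN N}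
    (h : HasWeakGradient w U) (φ : ContDiffBump (0 : RN N)) (hφ : φ.rOut ≤ 1) (R : ℝ) :
    ∫⁻ x in Metric.ball 0 R, ‖fderiv ℝ (w ⋆[lsmul ℝ ℝ] φ.normed volume) x‖ₑ ^ 2 ≤
      ∫⁻ y in Metric.ball 0 (R + 1), ‖U y‖ₑ ^ 2 := by
  set η : RN N → ℝ := φ.normed volume with hη
  have hηc : Continuous η := φ.continuous_normed
  have hone : ∫⁻ t, ‖η t‖ₑ = 1 := by
    rw [← ENNReal.ofReal_one, ← φ.integral_normed (μ := (volume : Measure (RN N))),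
      ofReal_integral_eq_lintegral_ofReal φ.integrable_normed
        (Filter.Eventually.of_forall φ.nonneg_normed)]
    simp only [hη, Real.enorm_of_nonneg (φ.nonneg_normed _)]
  have hone' : ∀ x, ∫⁻ t, ‖η (x - t)‖ₑ = 1 := fun x => by
    rw [lintegral_sub_left_eq_self (fun t => ‖η t‖ₑ) x, hone]
  have hone'' : ∀ t, ∫⁻ x, ‖η (x - t)‖ₑ = 1 := fun t => by
    rw [lintegral_sub_right_eq_self (fun x => ‖η x‖ₑ) t, hone]
  have hUm : AEMeasurable (fun t => ‖U t‖ₑ) volume := h.2.1.aestronglyMeasurable.enorm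
  have hpt : ∀ x, ‖fderiv ℝ (w ⋆[lsmul ℝ ℝ] η) x‖ₑ ^ 2 ≤ ∫⁻ t, ‖η (x - t)‖ₑ * ‖U t‖ₑ ^ 2 := by
    intro x
    rw [h.fderiv_convolution φ.contDiff_normed φ.hasCompactSupport_normed]
    have hsq : ∀ a : ℝ≥0∞, (a ^ (1 / 2 : ℝ)) ^ 2 = a := fun a => by
      rw [← ENNReal.rpow_natCast, ← ENNReal.rpow_mul]; norm_num
    calc ‖innerSL ℝ (∫ t, η (x - t) • U t)‖ₑ ^ 2
        = ‖∫ t, η (x - t) • U t‖ₑ ^ 2 := by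
          rw [← ofReal_norm, innerSL_apply_norm, ofReal_norm]
      _ ≤ (∫⁻ t, ‖η (x - t)‖ₑ * ‖U t‖ₑ) ^ 2 := by
          gcongr
          refine (enorm_integral_le_lintegral_enorm _).trans ?_
          simp only [enorm_smul, le_refl]
      -- Splitting η into two square roots makes Cauchy–Schwarz act as Jensen's inequality for a
      -- kernel of mass 1.
      _ = (∫⁻ t, ‖η (x - t)‖ₑ ^ (1 / 2 : ℝ) * (‖η (x - t)‖ₑ ^ (1 / 2 : ℝ) * ‖U t‖ₑ)) ^ 2 := by
          simp only [← mul_assoc, ← sq, hsq]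
      _ ≤ (∫⁻ t, (‖η (x - t)‖ₑ ^ (1 / 2 : ℝ)) ^ 2) *
            ∫⁻ t, (‖η (x - t)‖ₑ ^ (1 / 2 : ℝ) * ‖U t‖ₑ) ^ 2 := by
          refine sq_lintegral_mul_le (by fun_prop) (by fun_prop)
      _ = _ := by
          simp only [mul_pow, hsq, hone', one_mul]
  calc ∫⁻ x in Metric.ball 0 R, ‖fderiv ℝ (w ⋆[lsmul ℝ ℝ] η) x‖ₑ ^ 2
      ≤ ∫⁻ x in Metric.ball 0 R, ∫⁻ t, ‖η (x - t)‖ₑ * ‖U t‖ₑ ^ 2 := lintegral_mono hpt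
    _ = ∫⁻ t, ∫⁻ x in Metric.ball 0 R, ‖η (x - t)‖ₑ * ‖U t‖ₑ ^ 2 := by
        refine lintegral_lintegral_swap ?_
        unfold Function.uncurry
        have := hUm.comp_snd (μ := (volume : Measure (RN N)).restrict (Metric.ball 0 R))
        fun_prop
    _ ≤ ∫⁻ t, (Metric.ball 0 (R + 1)).indicator (fun t => ‖U t‖ₑ ^ 2) t := by
        refine lintegral_mono fun t => ?_
        have hm : Measurable fun x => ‖η (x - t)‖ₑ :=
          (hηc.comp (continuous_id.sub continuous_const)).enorm.measurable
        rw [lintegral_mul_const _ hm]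
        by_cases ht : t ∈ Metric.ball (0 : RN N) (R + 1)
        · rw [indicator_of_mem ht]
          refine mul_le_of_le_one_left' ?_
          exact (setLIntegral_le_lintegral _ _).trans (hone'' t).le
        · rw [setLIntegral_congr_fun (g := fun _ => 0) Metric.isOpen_ball.measurableSet]
          · simp
          · intro x hx
            have : η (x - t) = 0 := by
              rw [← Function.notMem_support, hη, φ.support_normed_eq, mem_ball_zero_iff]
              rw [mem_ball_zero_iff] at ht hx
              have := norm_sub_norm_le t x
              rw [norm_sub_rev] at this
              linarith
            simp [this]
    _ = _ := lintegral_indicator Metric.isOpen_ball.measurableSet _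

open ContinuousLinearMap Convolution in
/-- Approximation of weakly differentiable functions by smooth ones. -/
theorem HasWeakGradient.exists_contDiff_tendsto {w : RN N → ℝ} {U : RN N → RN N}
    (h : HasWeakGradient w U) (R : ℝ) :
    ∃ u : ℕ → RN N → ℝ, (∀ n, ContDiff ℝ 1 (u n)) ∧
      (∀ᵐ x, Filter.Tendsto (fun n => u n x) Filter.atTop (nhds (w x))) ∧
      ∀ n, ∫⁻ x in Metric.ball 0 R, ‖fderiv ℝ (u n) x‖ₑ ^ 2 ≤
        ∫⁻ y in Metric.ball 0 (R + 1), ‖U y‖ₑ ^ 2 := by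
  have hpos : ∀ n : ℕ, (0 : ℝ) < 1 / (n + 1) / 2 := fun n => by positivity
  -- The outer radii tend to 0 and stay at most 1, while the ratio of the radii is fixed at 2, as
  -- a.e. convergence of the mollifications requires.
  set φ : ℕ → ContDiffBump (0 : RN N) := fun n =>
    ⟨1 / (n + 1) / 2, 1 / (n + 1), hpos n, by have := hpos n; linarith⟩ with hφ
  refine ⟨fun n => w ⋆[lsmul ℝ ℝ] (φ n).normed volume, fun n => ?_, ?_, fun n => ?_⟩
  · exact (φ n).hasCompactSupport_normed.contDiff_convolution_right _ h.1 (φ n).contDiff_normed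
  · have := ContDiffBump.ae_convolution_tendsto_right_of_locallyIntegrable (φ := φ)
      (l := Filter.atTop) (K := 2) tendsto_one_div_add_atTop_nhds_zero_nat
      (Filter.Eventually.of_forall fun n => by
        simp only [hφ]; linarith) h.1
    filter_upwards [this] with x hx
    convert hx using 2 with n
    rw [convolution_eq_swap, convolution_def]
    simp [mul_comm]
  · refine h.lintegral_fderiv_convolution_le (φ n) ?_ R
    simp only [hφ]
    rw [div_le_one (by positivity)]
    linarith [(Nat.cast_nonneg n : (0 : ℝ) ≤ n)]

/-- Weighted Poincaré inequality for weakly differentiable functions, modulo constants. -/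
theorem exists_const_lintegral_sub_sq_le {β R : ℝ} (hR : 0 < R) (hβ : 0 ≤ β)
    (hβN : (N : ℝ) - 2 < β) {G : RN N → ℝ≥0∞}
    (hG : AEMeasurable G (volume.restrict (Metric.ball 0 R))) {M : ℝ≥0∞} (hM : M ≠ ⊤)
    (hGM : ∀ y ∈ Metric.ball (0 : RN N) R,
      ∫⁻ x in Metric.ball 0 R, G x * ‖x - y‖ₑ ^ (-β) ≤ M) :
    ∃ C : ℝ≥0∞, C ≠ ⊤ ∧ ∀ (w : RN N → ℝ) (U : RN N → RN N), HasWeakGradient w U →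
      ∃ c₀ : ℝ, ∫⁻ x in Metric.ball 0 R, G x * ‖w x - c₀‖ₑ ^ 2
        ≤ C * ∫⁻ y in Metric.ball 0 (R + 1), ‖U y‖ₑ ^ 2 := by
  obtain ⟨C, hC, hmain⟩ := lintegral_lintegral_sub_sq_le_of_contDiff hβ hβN hG hM hGM
  set B := Metric.ball (0 : RN N) R with hB
  have hvol0 : volume B ≠ 0 := (Metric.measure_ball_pos _ _ hR).ne'
  have hvolt : volume B ≠ ⊤ := measure_ball_lt_top.ne
  refine ⟨(volume B)⁻¹ * C, ENNReal.mul_ne_top (by simpa using hvol0) hC, fun w U h => ?_⟩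
  obtain ⟨u, hu1, hu2, hu3⟩ := h.exists_contDiff_tendsto R
  have hwm := h.1.aestronglyMeasurable.aemeasurable
  have hw1 := (hwm.restrict (s := B)).comp_fst (ν := volume.restrict B)
  have hw2 := (hwm.restrict (s := B)).comp_snd (μ := volume.restrict B)
  have hG1 := hG.comp_fst (ν := volume.restrict B)
  have hG2 := hG.comp_snd (μ := volume.restrict B)
  have hdouble : ∫⁻ x in B, ∫⁻ z in B, G x * ‖w x - w z‖ₑ ^ 2 ≤
      C * ∫⁻ y in Metric.ball 0 (R + 1), ‖U y‖ₑ ^ 2 := by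
    have hu2' := ae_restrict_of_ae (s := B) hu2
    have hprod : ∀ v : RN N → ℝ, AEMeasurable v (volume.restrict B) →
        ∫⁻ x in B, ∫⁻ z in B, G x * ‖v x - v z‖ₑ ^ 2 =
        ∫⁻ q, G q.1 * ‖v q.1 - v q.2‖ₑ ^ 2 ∂((volume.restrict B).prod (volume.restrict B)) := by
      intro v hv
      have hv1 := hv.comp_fst (ν := volume.restrict B)
      have hv2 := hv.comp_snd (μ := volume.restrict B)
      exact lintegral_lintegral (f := fun x z => G x * ‖v x - v z‖ₑ ^ 2) (by fun_prop)
    rw [hprod w hwm.restrict]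
    calc ∫⁻ q, G q.1 * ‖w q.1 - w q.2‖ₑ ^ 2 ∂((volume.restrict B).prod (volume.restrict B))
        ≤ ∫⁻ q, Filter.liminf (fun n => G q.1 * ‖u n q.1 - u n q.2‖ₑ ^ 2) Filter.atTop
            ∂((volume.restrict B).prod (volume.restrict B)) := by
          refine lintegral_mono_ae ?_
          filter_upwards [Measure.quasiMeasurePreserving_fst.ae hu2',
            Measure.quasiMeasurePreserving_snd.ae hu2'] with q hq1 hq2
          have hlim : Filter.Tendsto (fun n => ‖u n q.1 - u n q.2‖ₑ ^ 2) Filter.atTop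
              (nhds (‖w q.1 - w q.2‖ₑ ^ 2)) :=
            (((ENNReal.continuous_pow 2).comp continuous_enorm).tendsto _).comp (hq1.sub hq2)
          -- As `G` may be infinite, multiplication by it need not be continuous; only the
          -- inequality for the lower limit is used, and it suffices for Fatou.
          refine le_trans (le_of_eq ?_) (ENNReal.le_liminf_mul (u := fun _ => G q.1)
            (v := fun n => ‖u n q.1 - u n q.2‖ₑ ^ 2))
          rw [Filter.liminf_const, Filter.Tendsto.liminf_eq hlim]
      _ ≤ Filter.liminf (fun n => ∫⁻ q, G q.1 * ‖u n q.1 - u n q.2‖ₑ ^ 2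
            ∂((volume.restrict B).prod (volume.restrict B))) Filter.atTop := by
          refine lintegral_liminf_le' fun n => ?_
          have := (hu1 n).continuous
          fun_prop
      _ ≤ _ := by
          refine Filter.liminf_le_of_frequently_le' (Filter.Frequently.of_forall fun n => ?_)
          rw [← hprod (u n) (hu1 n).continuous.aemeasurable]
          exact (hmain (u n) (hu1 n)).trans (mul_le_mul' le_rfl (hu3 n))
  have hK : AEMeasurable (Function.uncurry fun x z => G x * ‖w x - w z‖ₑ ^ 2)
      ((volume.restrict B).prod (volume.restrict B)) :=
    hG1.mul ((hw1.sub hw2).enorm.pow_const 2)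
  -- Some z does no worse than the average over the ball, and w(z) is then the constant.
  obtain ⟨z, -, hz⟩ := exists_le_setLAverage (μ := volume) (s := B)
    (f := fun z => ∫⁻ x in B, G x * ‖w x - w z‖ₑ ^ 2) hvol0 hvolt hK.lintegral_prod_left
  refine ⟨w z, hz.trans ?_⟩
  rw [setLAverage_eq, ← lintegral_lintegral_swap hK, ENNReal.div_eq_inv_mul, mul_assoc]
  exact mul_le_mul' le_rfl hdouble

/-! ### Control of the gradient by the fractional energy -/

/-- On any ball containing `Ω`, a vector field is controlled in `L²` modulo constants by its
fractional energy on `Q(Ω)`. -/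
theorem exists_const_lintegral_sub_sq_le_energy {σ : ℝ} (hσ : 0 < σ) {Ω : Set (RN N)}
    (hΩo : IsOpen Ω) (hΩne : Ω.Nonempty) {R : ℝ} (hΩR : Ω ⊆ Metric.ball 0 R) :
    ∃ C : ℝ≥0∞, C ≠ ⊤ ∧ ∀ U : RN N → RN N, AEStronglyMeasurable U volume →
      ∃ c : RN N, ∫⁻ y in Metric.ball 0 R, ‖U y - c‖ₑ ^ 2 ≤
        C * ∫⁻ z in QSet Ω, ‖U z.1 - U z.2‖ₑ ^ 2 / ‖z.1 - z.2‖ₑ ^ ((N : ℝ) + 2 * σ) := by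
  set e : ℝ := (N : ℝ) + 2 * σ with he
  have he0 : 0 ≤ e := by positivity
  set B := Metric.ball (0 : RN N) R with hB
  have hBm : MeasurableSet B := Metric.isOpen_ball.measurableSet
  obtain ⟨x₀, hx₀⟩ := hΩne
  have hR : 0 < R := (norm_nonneg x₀).trans_lt (by simpa [hB] using hΩR hx₀)
  have hvol0 : volume Ω ≠ 0 := (hΩo.measure_pos _ ⟨x₀, hx₀⟩).ne'
  have hvolt : volume Ω ≠ ⊤ := ((measure_mono hΩR).trans_lt measure_ball_lt_top).ne
  set D := ENNReal.ofReal (2 * R) ^ e with hD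
  have hDt : D ≠ ⊤ := (ENNReal.rpow_lt_top_of_nonneg he0 ENNReal.ofReal_ne_top).ne
  have hD0 : D ≠ 0 := by
    rw [hD, Ne, ENNReal.rpow_eq_zero_iff]
    simp [hR, he0]
  refine ⟨(volume Ω)⁻¹ * D, ENNReal.mul_ne_top (by simpa using hvol0) hDt, fun U hU => ?_⟩
  have hU1 := (hU.restrict (s := Ω)).comp_fst (ν := volume.restrict B)
  have hU2 := (hU.restrict (s := B)).comp_snd (μ := volume.restrict Ω)
  have hK : AEMeasurable (Function.uncurry fun x y => ‖U x - U y‖ₑ ^ 2)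
      ((volume.restrict Ω).prod (volume.restrict B)) :=
    (hU1.sub hU2).enorm.pow_const 2
  -- One coordinate in Ω is enough to lie in Q(Ω). This is what lets the energy control U on the
  -- part of the ball outside Ω.
  have hsub : Ω ×ˢ B ⊆ QSet Ω := fun z hz hz' => hz'.1 hz.1
  have hdouble : ∫⁻ x in Ω, ∫⁻ y in B, ‖U x - U y‖ₑ ^ 2 ≤
      D * ∫⁻ z in QSet Ω, ‖U z.1 - U z.2‖ₑ ^ 2 / ‖z.1 - z.2‖ₑ ^ e := by
    rw [lintegral_lintegral hK, Measure.prod_restrict, ← Measure.volume_eq_prod,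
      ← lintegral_const_mul' _ _ hDt]
    calc ∫⁻ z in Ω ×ˢ B, ‖U z.1 - U z.2‖ₑ ^ 2
        ≤ ∫⁻ z in Ω ×ˢ B, D * (‖U z.1 - U z.2‖ₑ ^ 2 / ‖z.1 - z.2‖ₑ ^ e) := by
          refine setLIntegral_mono' (hΩo.measurableSet.prod hBm) fun z hz => ?_
          have hle : ‖z.1 - z.2‖ₑ ^ e ≤ D := by
            refine ENNReal.rpow_le_rpow ?_ he0
            rw [← ofReal_norm]
            refine ENNReal.ofReal_le_ofReal ((norm_sub_le _ _).trans ?_)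
            have h1 := hΩR hz.1
            have h2 := hz.2
            rw [hB, mem_ball_zero_iff] at h1 h2
            linarith
          calc ‖U z.1 - U z.2‖ₑ ^ 2 = D * (‖U z.1 - U z.2‖ₑ ^ 2 / D) :=
                (ENNReal.mul_div_cancel hD0 hDt).symm
            _ ≤ _ := by gcongr
      _ ≤ _ := lintegral_mono_set hsub
  obtain ⟨x, -, hx⟩ := exists_le_setLAverage (μ := volume) (s := Ω)
    (f := fun x => ∫⁻ y in B, ‖U x - U y‖ₑ ^ 2) hvol0 hvolt hK.lintegral_prod_right
  refine ⟨U x, ?_⟩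
  simp only [enorm_sub_rev (U x)] at hx
  refine hx.trans ?_
  rw [setLAverage_eq, ENNReal.div_eq_inv_mul, mul_assoc]
  exact mul_le_mul' le_rfl hdouble

/-! ### The measure μ_g and the Poincaré inequality modulo affine functions -/

/-- The weight `χ_Ω + |g| χ_{Ωᶜ}` as a real function. -/
noncomputable def weight (Ω : Set (RN N)) (g : RN N → ℝ) (x : RN N) : ℝ :=
  Ω.indicator 1 x + Ωᶜ.indicator g x

theorem enorm_weight (Ω : Set (RN N)) (g : RN N → ℝ) (x : RN N) :
    ‖weight Ω g x‖ₑ = Ω.indicator 1 x + Ωᶜ.indicator (fun y => ‖g y‖ₑ) x := by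
  by_cases hx : x ∈ Ω <;> simp [weight, hx]

theorem lintegral_muG {Ω : Set (RN N)} (hΩ : MeasurableSet Ω) {g : RN N → ℝ}
    (hg : AEStronglyMeasurable g (volume.restrict Ωᶜ)) {f : RN N → ℝ≥0∞}
    (hf : AEMeasurable f volume) :
    ∫⁻ x, f x ∂(muG Ω g) = ∫⁻ x, ‖weight Ω g x‖ₑ * f x := by
  have hm : AEMeasurable (fun x => ‖weight Ω g x‖ₑ) volume := by
    simp only [enorm_weight]
    exact (measurable_one.indicator hΩ).aemeasurable.add
      ((aemeasurable_indicator_iff hΩ.compl).2 hg.enorm)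
  have : muG Ω g = volume.withDensity fun x => ‖weight Ω g x‖ₑ := by
    simp only [muG, enorm_weight]
  rw [this, lintegral_withDensity_eq_lintegral_mul₀ hm hf]
  rfl

theorem lintegral_muG_eq_add {Ω : Set (RN N)} (hΩ : MeasurableSet Ω) {g : RN N → ℝ}
    (hg : AEStronglyMeasurable g (volume.restrict Ωᶜ)) {f : RN N → ℝ≥0∞}
    (hf : AEMeasurable f volume) :
    ∫⁻ x, f x ∂(muG Ω g) = (∫⁻ x in Ω, f x) + ∫⁻ x in Ωᶜ, ‖g x‖ₑ * f x := by
  rw [lintegral_muG hΩ hg hf, ← lintegral_add_compl _ hΩ]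
  congr 1
  · refine setLIntegral_congr_fun hΩ fun x hx => ?_
    simp [weight, hx]
  · refine setLIntegral_congr_fun hΩ.compl fun x hx => ?_
    have : x ∉ Ω := hx
    simp [weight, this]

/-- Poincaré inequality modulo affine functions. -/
theorem exists_affine_lintegral_muG_le (hN : 1 ≤ N) {σ : ℝ} (hσ : 0 < σ) {Ω : Set (RN N)}
    (hΩo : IsOpen Ω) (hΩb : Bornology.IsBounded Ω) (hΩne : Ω.Nonempty) {p : ℝ≥0∞} (hp1 : 1 ≤ p)
    (hpN : (N : ℝ≥0∞) / 2 < p) {g : RN N → ℝ} (hg : MemLp g p (volume.restrict Ωᶜ))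
    (hgc : ∃ K : Set (RN N), IsCompact K ∧ ∀ᵐ x ∂(volume.restrict Ωᶜ), x ∉ K → g x = 0) :
    ∃ C : ℝ≥0∞, C ≠ ⊤ ∧ ∀ u : RN N → ℝ, WeaklyDifferentiable u → ∃ ℓ ∈ Affine1 N,
      ∫⁻ x, ‖u x - ℓ x‖ₑ ^ 2 ∂(muG Ω g) ≤ C * energy Ω σ u := by
  obtain ⟨K, hK, hgK⟩ := hgc
  -- This ball carries all of μ_g: it contains Ω and the set outside which g vanishes.
  obtain ⟨R, hR, hΩK⟩ := (hΩb.union hK.isBounded).subset_ball_lt 0 0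
  have hΩR : Ω ⊆ Metric.ball 0 R := subset_union_left.trans hΩK
  have hKR : K ⊆ Metric.ball 0 R := subset_union_right.trans hΩK
  have hΩm := hΩo.measurableSet
  have : IsFiniteMeasure (volume.restrict (Metric.ball (0 : RN N) R)) :=
    ⟨by simpa using measure_ball_lt_top⟩
  have hw : MemLp (weight Ω g) p (volume.restrict (Metric.ball 0 R)) := by
    refine MemLp.add ?_ ?_
    · exact (memLp_const (1 : ℝ)).indicator hΩm
    · exact ((memLp_indicator_iff_restrict hΩm.compl).2 hg).restrict _
  obtain ⟨β, hβ0, hβN, M, hM, hkernel⟩ := exists_rpow_kernel_bound hN hp1 hpN hw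
  obtain ⟨C₁, hC₁, h₁⟩ := exists_const_lintegral_sub_sq_le hR hβ0 hβN hw.1.enorm hM hkernel
  -- The gradient is needed on the ball of radius R + 1, since mollification enlarges the domain by
  -- 1.
  obtain ⟨C₂, hC₂, h₂⟩ := exists_const_lintegral_sub_sq_le_energy hσ hΩo hΩne
    (hΩR.trans (Metric.ball_subset_ball (by linarith : R ≤ R + 1)))
  refine ⟨C₁ * C₂, ENNReal.mul_ne_top hC₁ hC₂, fun u hu => ?_⟩
  have hU := weakGrad_spec hu
  obtain ⟨c, hc⟩ := h₂ (weakGrad u) hU.2.1.aestronglyMeasurable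
  -- The weighted inequality is applied to u - (c, x), whose gradient is ∇u - c.
  obtain ⟨c₀, hc₀⟩ := h₁ _ _ (hU.add_affine (c₀ := 0) (c := -c) fun x => rfl)
  refine ⟨fun x => c₀ + inner ℝ c x, ⟨c₀, c, fun x => rfl⟩, ?_⟩
  have hum : AEMeasurable u volume := hU.1.aestronglyMeasurable.aemeasurable
  rw [lintegral_muG hΩm hg.1 (by fun_prop)]
  calc ∫⁻ x, ‖weight Ω g x‖ₑ * ‖u x - (c₀ + inner ℝ c x)‖ₑ ^ 2
      = ∫⁻ x, (Metric.ball 0 R).indicator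
          (fun x => ‖weight Ω g x‖ₑ * ‖u x + (0 + inner ℝ (-c) x) - c₀‖ₑ ^ 2) x := by
        refine lintegral_congr_ae ?_
        filter_upwards [(ae_restrict_iff' hΩm.compl).1 hgK] with x hx
        by_cases hxR : x ∈ Metric.ball (0 : RN N) R
        · rw [indicator_of_mem hxR]
          congr 3
          rw [inner_neg_left]
          ring
        · have hxΩ : x ∉ Ω := fun h => hxR (hΩR h)
          have hxK : x ∉ K := fun h => hxR (hKR h)
          rw [indicator_of_notMem hxR]
          simp [weight, hxΩ, hx hxΩ hxK]
    _ = ∫⁻ x in Metric.ball 0 R,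
          ‖weight Ω g x‖ₑ * ‖u x + (0 + inner ℝ (-c) x) - c₀‖ₑ ^ 2 :=
        lintegral_indicator Metric.isOpen_ball.measurableSet _
    _ ≤ C₁ * ∫⁻ y in Metric.ball 0 (R + 1), ‖weakGrad u y + -c‖ₑ ^ 2 := hc₀
    _ ≤ C₁ * (C₂ * energy Ω σ u) := by
        simp only [← sub_eq_add_neg]
        exact mul_le_mul' le_rfl hc
    _ = _ := (mul_assoc _ _ _).symm

/-! ### Orthogonality and unique continuation -/

theorem Affine1.continuous {ℓ : RN N → ℝ} (h : ℓ ∈ Affine1 N) : Continuous ℓ := by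
  obtain ⟨c₀, c, hc⟩ := h
  obtain rfl : ℓ = fun x => c₀ + inner ℝ c x := funext hc
  fun_prop

/-- An affine function vanishing on a nonempty open set vanishes. -/
theorem Affine1.eq_zero_of_eqOn {ℓ : RN N → ℝ} (h : ℓ ∈ Affine1 N) {Ω : Set (RN N)}
    (hΩo : IsOpen Ω) (hΩne : Ω.Nonempty) (h0 : EqOn ℓ 0 Ω) : ℓ = 0 := by
  obtain ⟨c₀, c, hc⟩ := h
  obtain ⟨x₀, hx₀⟩ := hΩne
  have hcont : Continuous fun t : ℝ => x₀ + t • c := by fun_prop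
  have hev : ∀ᶠ t : ℝ in nhds 0, x₀ + t • c ∈ Ω :=
    hcont.continuousAt.eventually (hΩo.mem_nhds (by simpa using hx₀))
  obtain ⟨ε, hε, hball⟩ := Metric.eventually_nhds_iff.1 hev
  -- Moving from x₀ in the direction c changes ℓ by (ε/2)|c|², which forces c = 0.
  have hmem : x₀ + (ε / 2) • c ∈ Ω := hball (by
    rw [Real.dist_eq, sub_zero, abs_of_pos (by positivity)]; linarith)
  have h1 := h0 hx₀
  have h2 := h0 hmem
  simp only [hc, Pi.zero_apply, inner_add_right, inner_smul_right] at h1 h2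
  have h3 : ε / 2 * inner ℝ c c = 0 := by linarith
  have hc0 : c = 0 := by
    rcases mul_eq_zero.1 h3 with h | h
    · linarith
    · exact inner_self_eq_zero.1 h
  funext x
  simp only [hc, hc0, inner_zero_left, Pi.zero_apply] at h1 ⊢
  exact h1

/-- Orthogonality to the affine functions gives the minimality of the `L²(μ_g)` norm. -/
theorem HOrth.lintegral_sq_le {Ω : Set (RN N)} {σ : ℝ} {g v ℓ : RN N → ℝ}
    (hv : v ∈ HOrth Ω σ g) (hℓ : ℓ ∈ Affine1 N)
    (hfin : ∫⁻ x, ‖v x - ℓ x‖ₑ ^ 2 ∂(muG Ω g) ≠ ⊤) :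
    ∫⁻ x, ‖v x‖ₑ ^ 2 ∂(muG Ω g) ≤ ∫⁻ x, ‖v x - ℓ x‖ₑ ^ 2 ∂(muG Ω g) := by
  obtain ⟨⟨hwd, -⟩, horth⟩ := hv
  obtain ⟨hi, h0⟩ := horth ℓ hℓ
  have hac : muG Ω g ≪ volume := withDensity_absolutelyContinuous _ _
  have hvm : AEStronglyMeasurable v (muG Ω g) :=
    (weakGrad_spec hwd).1.aestronglyMeasurable.mono_ac hac
  have hm : AEStronglyMeasurable (fun x => v x - ℓ x) (muG Ω g) :=
    hvm.sub (Affine1.continuous hℓ).aestronglyMeasurable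
  have hsq : ∀ a : ℝ, ‖a‖ₑ ^ 2 = ENNReal.ofReal (a ^ 2) := fun a => by
    rw [← ofReal_norm, ← ENNReal.ofReal_pow (norm_nonneg a), Real.norm_eq_abs, sq_abs]
  have hid : Integrable (fun x => (v x - ℓ x) ^ 2) (muG Ω g) := by
    refine ⟨hm.pow 2, ?_⟩
    rw [hasFiniteIntegral_iff_ofReal (Filter.Eventually.of_forall fun x => sq_nonneg _)]
    simpa only [hsq] using hfin.lt_top
  -- Square integrability of v is not assumed: v² + ℓ² = (v - ℓ)² + 2vℓ is a sum of two integrable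
  -- functions.
  have his : Integrable (fun x => v x ^ 2 + ℓ x ^ 2) (muG Ω g) := by
    refine (hid.add (hi.const_mul 2)).congr (Filter.Eventually.of_forall fun x => ?_)
    simp only [Pi.add_apply]
    ring
  have heq : ∫ x, v x ^ 2 + ℓ x ^ 2 ∂(muG Ω g) = ∫ x, (v x - ℓ x) ^ 2 ∂(muG Ω g) := by
    have h1 : ∫ x, (v x - ℓ x) ^ 2 + 2 * (v x * ℓ x) ∂(muG Ω g) =
        ∫ x, (v x - ℓ x) ^ 2 ∂(muG Ω g) := by
      rw [integral_add hid (hi.const_mul 2), integral_const_mul, h0, mul_zero, add_zero]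
    rw [← h1]
    congr 1 with x
    ring
  calc ∫⁻ x, ‖v x‖ₑ ^ 2 ∂(muG Ω g)
      ≤ ∫⁻ x, ENNReal.ofReal (v x ^ 2 + ℓ x ^ 2) ∂(muG Ω g) := by
        refine lintegral_mono fun x => ?_
        rw [hsq]
        exact ENNReal.ofReal_le_ofReal (by linarith [sq_nonneg (ℓ x)])
    _ = ∫⁻ x, ‖v x - ℓ x‖ₑ ^ 2 ∂(muG Ω g) := by
        rw [← ofReal_integral_eq_lintegral_ofReal his
          (Filter.Eventually.of_forall fun x => by positivity), heq,
          ofReal_integral_eq_lintegral_ofReal hid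
          (Filter.Eventually.of_forall fun x => by positivity)]
        simp only [hsq]

/-- Unique continuation for zero energy: such functions are affine, hence determined by their
values in `Ω`. -/
theorem ae_eq_zero_of_energy_eq_zero (hN : 1 ≤ N) {σ : ℝ} (hσ : 0 < σ) {Ω : Set (RN N)}
    (hΩo : IsOpen Ω) (hΩb : Bornology.IsBounded Ω) (hΩne : Ω.Nonempty) {v : RN N → ℝ}
    (hv : WeaklyDifferentiable v) (hE : energy Ω σ v = 0)
    (h0 : ∀ᵐ x ∂(volume.restrict Ω), v x = 0) : v =ᵐ[volume] 0 := by
  have hvm : AEMeasurable v volume := (weakGrad_spec hv).1.aestronglyMeasurable.aemeasurable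
  have key : ∀ n : ℕ, ∀ᵐ x : RN N, x ∈ Metric.ball (0 : RN N) n → v x = 0 := by
    intro n
    -- An auxiliary weight makes the Poincaré inequality see the ball of radius n. Its constant may
    -- depend on n, because the energy is zero.
    set g : RN N → ℝ := (Metric.ball (0 : RN N) n).indicator 1 with hg
    have hgm : Measurable g := measurable_one.indicator Metric.isOpen_ball.measurableSet
    have hgLp : MemLp g ⊤ (volume.restrict Ωᶜ) := by
      refine memLp_top_of_bound hgm.aestronglyMeasurable 1 (Filter.Eventually.of_forall fun x => ?_)
      by_cases hx : x ∈ Metric.ball (0 : RN N) n <;> simp [g, hx]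
    obtain ⟨C, hC, h⟩ := exists_affine_lintegral_muG_le hN hσ hΩo hΩb hΩne (p := ⊤) le_top
      (ENNReal.div_lt_top (by simp) (by simp)) hgLp
      ⟨Metric.closedBall 0 n, isCompact_closedBall _ _, Filter.Eventually.of_forall fun x hx =>
        indicator_of_notMem (fun h => hx (Metric.ball_subset_closedBall h)) _⟩
    obtain ⟨ℓ, hℓ, hle⟩ := h v hv
    have hm : AEMeasurable (fun x => ‖v x - ℓ x‖ₑ ^ 2) volume := by
      have := (Affine1.continuous hℓ).measurable
      fun_prop
    rw [hE, mul_zero, lintegral_muG hΩo.measurableSet hgm.aestronglyMeasurable hm,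
      nonpos_iff_eq_zero, lintegral_eq_zero_iff'] at hle
    · have hΩℓ : ∀ᵐ x ∂(volume.restrict Ω), ℓ x = 0 := by
        filter_upwards [h0, ae_restrict_of_ae hle, ae_restrict_mem hΩo.measurableSet]
          with x hx1 hx2 hx3
        simpa [weight, hx3, hx1] using hx2
      have hℓ0 : ℓ = 0 := Affine1.eq_zero_of_eqOn hℓ hΩo hΩne
        (Measure.eqOn_open_of_ae_eq hΩℓ hΩo (Affine1.continuous hℓ).continuousOn
          continuousOn_const)
      filter_upwards [hle] with x hx hxn
      by_cases hxΩ : x ∈ Ω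
      · simpa [weight, hxΩ, hℓ0] using hx
      · simpa [weight, hxΩ, hℓ0, g, hxn] using hx
    · have h1 : Measurable (weight Ω g) :=
        (measurable_one.indicator hΩo.measurableSet).add (hgm.indicator hΩo.measurableSet.compl)
      exact h1.enorm.aemeasurable.mul hm
  filter_upwards [ae_all_iff.2 key] with x hx
  obtain ⟨n, hn⟩ := exists_nat_gt ‖x‖
  exact hx n (by simpa using hn)

theorem WeaklyDifferentiable.sub_affine {u ℓ : RN N → ℝ} (hu : WeaklyDifferentiable u)
    (hℓ : ℓ ∈ Affine1 N) : WeaklyDifferentiable fun x => u x - ℓ x := by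
  obtain ⟨U, hU⟩ := hu
  obtain ⟨c₀, c, hc⟩ := hℓ
  refine ⟨_, (hU.add_affine (p := fun x => -ℓ x) (c₀ := -c₀) (c := -c) fun x => ?_)⟩
  rw [hc, inner_neg_left]
  ring

end FracNeumann

open FracNeumann

/-! ### The three assertions -/

theorem lemma4p3 {N : ℕ} (hN : 1 ≤ N) (σ : ℝ) (hσ0 : 0 < σ) (hσ1 : σ < 1)
    (Ω : Set (FracNeumann.RN N)) (hΩo : IsOpen Ω) (hΩb : Bornology.IsBounded Ω)
    (hΩne : Ω.Nonempty)
    (p : ℝ≥0∞) (hp1 : 1 ≤ p) (hpN : (N : ℝ≥0∞) / 2 < p)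
    (g₁ : FracNeumann.RN N → ℝ) (hg : MemLp g₁ p (volume.restrict Ωᶜ))
    (hgc : ∃ K : Set (FracNeumann.RN N), IsCompact K ∧
      ∀ᵐ x ∂(volume.restrict Ωᶜ), x ∉ K → g₁ x = 0) :
    0 < FracNeumann.lambda1 Ω σ g₁ ∧
    (∃ C : ℝ, 0 < C ∧ ∀ v ∈ FracNeumann.HOrth Ω σ g₁,
      (∫⁻ x in Ω, ‖v x‖ₑ ^ 2) + (∫⁻ x in Ωᶜ, ‖g₁ x‖ₑ * ‖v x‖ₑ ^ 2)
        ≤ ENNReal.ofReal C * FracNeumann.energy Ω σ v) ∧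
    (∃ C : ℝ, 0 < C ∧ ∀ q : FracNeumann.HsQuot Ω σ g₁,
      1 / C * q.starNorm ≤ q.quotNorm ∧ q.quotNorm ≤ C * q.starNorm) := by
  obtain ⟨C, hC, hmain⟩ := FracNeumann.exists_affine_lintegral_muG_le hN hσ0 hΩo hΩb hΩne
    hp1 hpN hg hgc
  have hΩm := hΩo.measurableSet
  have hmeas : ∀ u : RN N → ℝ, WeaklyDifferentiable u →
      AEMeasurable (fun x => ‖u x‖ₑ ^ 2) volume := fun u hu =>
    (weakGrad_spec hu).1.aestronglyMeasurable.enorm.pow_const 2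
  have hsplit : ∀ u : RN N → ℝ, WeaklyDifferentiable u → ∫⁻ x, ‖u x‖ₑ ^ 2 ∂(muG Ω g₁) =
      (∫⁻ x in Ω, ‖u x‖ₑ ^ 2) + ∫⁻ x in Ωᶜ, ‖g₁ x‖ₑ * ‖u x‖ₑ ^ 2 := fun u hu =>
    lintegral_muG_eq_add hΩm hg.1 (hmeas u hu)
  have horth : ∀ v ∈ HOrth Ω σ g₁, ∫⁻ x, ‖v x‖ₑ ^ 2 ∂(muG Ω g₁) ≤ C * energy Ω σ v := by
    intro v hv
    obtain ⟨ℓ, hℓ, hle⟩ := hmain v hv.1.1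
    exact (HOrth.lintegral_sq_le hv hℓ
      (hle.trans_lt (ENNReal.mul_lt_top hC.lt_top hv.1.2)).ne).trans hle
  -- Adding 1 makes the constant positive even if C = 0.
  have hCC : C ≤ ENNReal.ofReal (C.toReal + 1) := by
    rw [ENNReal.ofReal_add ENNReal.toReal_nonneg zero_le_one, ENNReal.ofReal_toReal hC]
    exact le_self_add
  refine ⟨?_, ⟨C.toReal + 1, by positivity, fun v hv => ?_⟩, ?_⟩
  · refine lt_of_lt_of_le (ENNReal.inv_pos.2 hC) (le_iInf₂ fun u hu => ?_)
    obtain ⟨hu, hne⟩ := hu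
    have hle := horth u hu
    have hfin : ∫⁻ x, ‖u x‖ₑ ^ 2 ∂(muG Ω g₁) ≠ ⊤ :=
      (hle.trans_lt (ENNReal.mul_lt_top hC.lt_top hu.1.2)).ne
    -- The quotient 0/0 equals 0 in `ℝ≥0∞` and would destroy the lower bound C⁻¹; unique
    -- continuation excludes it.
    have hnz : ∫⁻ x, ‖u x‖ₑ ^ 2 ∂(muG Ω g₁) ≠ 0 ∨ energy Ω σ u ≠ 0 := by
      by_contra! hcon
      refine hne (ae_eq_zero_of_energy_eq_zero hN hσ0 hΩo hΩb hΩne hu.1.1 hcon.2 ?_)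
      have h0 := hcon.1
      rw [hsplit u hu.1.1, add_eq_zero, lintegral_eq_zero_iff' (hmeas u hu.1.1).restrict] at h0
      filter_upwards [h0.1] with x hx
      simpa using hx
    rw [ENNReal.le_div_iff_mul_le hnz (Or.inl hfin), mul_comm, ← div_eq_mul_inv]
    exact ENNReal.div_le_of_le_mul' hle
  · rw [← hsplit v hv.1.1]
    exact (horth v hv).trans (mul_le_mul' hCC le_rfl)
  · have hstar : ∀ u : HsN Ω σ g₁, (HsQuot.mk u).starNorm = u.seminorm := fun _ => rfl
    have hnorm : ∀ u : HsN Ω σ g₁, u.seminorm ≤ u.norm := fun u => by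
      refine Real.sqrt_le_sqrt (ENNReal.toReal_mono u.2.2.ne ?_)
      rw [normHsSq, add_right_comm]
      exact le_add_self
    have hbdd : ∀ q : HsQuot Ω σ g₁,
        BddBelow {r | ∃ v : HsN Ω σ g₁, HsQuot.mk v = q ∧ r = v.norm} := fun q =>
      ⟨0, by rintro _ ⟨v, -, rfl⟩; exact Real.sqrt_nonneg _⟩
    refine ⟨C.toReal + 1, by positivity, fun q => ?_⟩
    have hC1 : 1 ≤ C.toReal + 1 := by linarith [ENNReal.toReal_nonneg (a := C)]
    obtain ⟨u, rfl⟩ : ∃ u, HsQuot.mk u = q := Quotient.exists_rep q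
    constructor
    -- D is the same for all representatives and bounded by each of their norms, hence by the
    -- infimum.
    · refine (mul_le_of_le_one_left (Real.sqrt_nonneg _) ?_).trans
        (le_csInf ⟨_, u, rfl, rfl⟩ ?_)
      · rw [div_le_one (by positivity)]; exact hC1
      · rintro _ ⟨v, hv, rfl⟩
        have h := hnorm v
        rwa [← hstar, hv] at h
    · obtain ⟨ℓ, hℓ, hle⟩ := hmain u.1 u.2.1
      have hwd := WeaklyDifferentiable.sub_affine u.2.1 hℓ
      have hrel : ∃ q ∈ Affine1 N, u.1 =ᵐ[volume] fun x => (u.1 x - ℓ x) + q x :=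
        ⟨ℓ, hℓ, by simp⟩
      have hE := energy_eq_of_affine (Ω := Ω) (σ := σ) u.2.1 hwd hrel
      have hEfin : energy Ω σ u.1 < ⊤ := by
        refine lt_of_le_of_lt ?_ u.2.2
        rw [normHsSq, add_right_comm]
        exact le_add_self
      have hbound : normHsSq Ω σ g₁ (fun x => u.1 x - ℓ x) ≤ (C + 1) * energy Ω σ u.1 := by
        rw [normHsSq, add_right_comm, ← hsplit _ hwd, ← hE, add_mul, one_mul]
        gcongr
      have hfin : (C + 1) * energy Ω σ u.1 < ⊤ := ENNReal.mul_lt_top (by finiteness) hEfin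
      -- The representative u - ℓ has squared norm at most (C + 1) D(u)², so it bounds the infimum
      -- from above.
      let v : HsN Ω σ g₁ := ⟨fun x => u.1 x - ℓ x, hwd, hbound.trans_lt hfin⟩
      have hvu : HsQuot.mk v = HsQuot.mk u :=
        (Quotient.sound (s := HsN.affineSetoid Ω σ g₁) hrel).symm
      refine (csInf_le (hbdd _) ⟨v, hvu, rfl⟩).trans ?_
      rw [hstar, HsN.norm, HsN.seminorm]
      calc √(normHsSq Ω σ g₁ v.1).toReal
          ≤ √((C.toReal + 1) * (energy Ω σ u.1).toReal) := by
            refine Real.sqrt_le_sqrt ?_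
            have := ENNReal.toReal_mono hfin.ne hbound
            rwa [ENNReal.toReal_mul, ENNReal.toReal_add hC ENNReal.one_ne_top,
              ENNReal.toReal_one] at this
        _ = √(C.toReal + 1) * √(energy Ω σ u.1).toReal :=
            Real.sqrt_mul (by positivity) _
        _ ≤ _ := by
            gcongr
            exact Real.sqrt_le_iff.2 ⟨by positivity, by nlinarith⟩
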